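/- For $N\in\mathbb N_0$ put $S_N=\sum_{k=1}^{N}\left(\frac1k-\log\frac{k+1}{k}\right)$, and let $\gamma$ denote Euler's constant. Let $b,c,r,n$ be positive integers such that $2b\ge c$ and $c$ is even. Then $$ \left|\gamma-\frac{((cn)!)^2}{(2cn)!\,r^{2cn}}\sum_{k=0}^{2cn}(-1)^{k}\binom{2cn}{k}\binom{rk+\left(b+\frac c2\right)n}{cn}^2S_{rk+bn}\right|<cn\left(\frac{b^{\frac br}c^{2c}}{2^c(b+2cr)^{2c+\frac br}}\right)^n. $$ -/

import Mathlib

/-- The partial sums `S_N = ∑_{k=1}^N (1/k - log ((k+1)/k))` of the standard series for Euler's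
constant. -/
noncomputable def eulerPartialSum (N : ℕ) : ℝ :=
  ∑ k ∈ Finset.Icc 1 N, (1 / (k : ℝ) - Real.log (((k : ℝ) + 1) / (k : ℝ)))

/-! The remainder `γ - S_N` is the double integral of `x^N (1 - x^t)/(1 - x)` over the unit square
(`eulerMascheroniConstant_sub_eulerPartialSum`). By `sum_choose_sq` the normalised weights sum to 1,
so the error is the integral of a polynomial `G` against `(1 - x^t)/(1 - x)`. With `m = cn = 2h` and
`a = bn`, `m!² G = x^h D^m x^m D^m f`, where `f = x^(a+h) (1 - x^r)^(2m)`.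

For `0 < t < 1` the weight is a positive mixture of Cauchy kernels `1/(x+u)`, so it suffices to
bound `G` against each kernel. Integrating by parts twice leaves `f` times `(-u)^h (x+u)^(-m-1)
P_m(u/(x+u))`, with `P_m` the shifted Legendre polynomial. Now `|P_m| ≤ 1`, `f ≤ B x^h` and `4ux ≤
(x+u)²` give the bound `B/4^h` times the kernel integral. Integrating back over `u` and `t` gives `B
γ/4^h`; the maximum of `x^b (1 - x^r)^(2c)` and a central binomial estimate finish. -/

/-! ### Legendre polynomials on the unit interval -/

/-- A shifted Legendre polynomial is bounded by `1` in absolute value on `[0, 1]`. -/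
theorem abs_aeval_shiftedLegendre_le_one (m : ℕ) {y : ℝ} (hy0 : 0 ≤ y) (hy1 : y ≤ 1) :
    |Polynomial.aeval y (Polynomial.shiftedLegendre m)| ≤ 1 := by
  -- It suffices to treat the open interval, by continuity.
  suffices h : Set.Ioo (0 : ℝ) 1 ⊆
      {y : ℝ | |Polynomial.aeval y (Polynomial.shiftedLegendre m)| ≤ 1} by
    have hc : IsClosed {y : ℝ | |Polynomial.aeval y (Polynomial.shiftedLegendre m)| ≤ 1} :=
      isClosed_le (by fun_prop) continuous_const
    have := closure_minimal h hc
    rw [closure_Ioo (by norm_num)] at this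
    exact this ⟨hy0, hy1⟩
  clear hy0 hy1 y
  rintro y ⟨hy0, hy1⟩
  -- Cauchy's estimate for the `m`-th derivative of `(z(1-z))^m` on the circle of radius `R` about
  -- `y`. There `|z(1-z)|² = R²(1 - 4(Re z - y)²) ≤ R²`, so the powers of `R` cancel.
  set R : ℝ := Real.sqrt (y * (1 - y)) with hR
  have hRpos : 0 < R := Real.sqrt_pos.2 (mul_pos hy0 (by linarith))
  have hR2 : R ^ 2 = y * (1 - y) := Real.sq_sqrt (mul_pos hy0 (by linarith)).le
  let p : Polynomial ℤ := Polynomial.X ^ m * (1 - Polynomial.X) ^ m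
  have hder : ∀ n : ℕ, iteratedDeriv n (fun z : ℂ => Polynomial.aeval z p) =
      fun z : ℂ => Polynomial.aeval z (Polynomial.derivative^[n] p) := by
    intro n
    induction n with
    | zero => simp
    | succ n ih =>
      rw [iteratedDeriv_succ, ih]
      funext z
      rw [Function.iterate_succ_apply']
      exact (Polynomial.hasDerivAt_aeval _ z).deriv
  have hsphere : ∀ z ∈ Metric.sphere (y : ℂ) R, ‖Polynomial.aeval z p‖ ≤ R ^ m := by
    intro z hz
    have hzR : ‖z - y‖ = R := by simpa [dist_eq_norm] using hz
    have hval : Polynomial.aeval z p = (z * (1 - z)) ^ m := by simp [p, mul_pow]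
    rw [hval, norm_pow]
    refine pow_le_pow_left₀ (norm_nonneg _) ?_ m
    have h1 : (z.re - y) ^ 2 + z.im ^ 2 = R ^ 2 := by
      rw [← hzR, ← Complex.normSq_eq_norm_sq, Complex.normSq_apply]
      simp; ring
    refine abs_le_of_sq_le_sq' ?_ hRpos.le |>.2
    rw [norm_mul, mul_pow, ← Complex.normSq_eq_norm_sq, ← Complex.normSq_eq_norm_sq,
      Complex.normSq_apply, Complex.normSq_apply]
    simp only [Complex.sub_re, Complex.sub_im, Complex.one_re, Complex.one_im, zero_sub]
    have e1 : z.im ^ 2 = R ^ 2 - (z.re - y) ^ 2 := by linarith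
    have e2 : (z.re * z.re + z.im * z.im) = 2 * z.re * y - y ^ 2 + R ^ 2 := by nlinarith
    have e3 : ((1 - z.re) * (1 - z.re) + -z.im * -z.im) =
        1 - 2 * z.re + (2 * z.re * y - y ^ 2 + R ^ 2) := by nlinarith
    have hs : (z.re - y) ^ 2 ≤ y * (1 - y) := by nlinarith [sq_nonneg z.im]
    rw [e2, e3, hR2]
    nlinarith [hs]
  have hC := Complex.norm_iteratedDeriv_le_of_forall_mem_sphere_norm_le m hRpos
    (f := fun z : ℂ => Polynomial.aeval z p)
    (by
      have : Differentiable ℂ (fun z : ℂ => Polynomial.aeval z p) := p.differentiable_aeval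
      exact this.diffContOnCl) hsphere
  rw [hder, ← Polynomial.factorial_mul_shiftedLegendre_eq] at hC
  have hofReal : Polynomial.aeval (y : ℂ) (Polynomial.shiftedLegendre m) =
      ((Polynomial.aeval y (Polynomial.shiftedLegendre m) : ℝ) : ℂ) := by
    exact Polynomial.aeval_algebraMap_apply ℂ y _
  have hm : (0 : ℝ) < m.factorial := by positivity
  beta_reduce at hC
  rw [mul_div_assoc, div_self (pow_pos hRpos m).ne', map_mul, map_natCast, norm_mul, hofReal,
    Complex.norm_real, Complex.norm_natCast, Real.norm_eq_abs] at hC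
  exact le_of_mul_le_mul_left hC hm

/-! ### Integration by parts against Cauchy kernels -/

open Polynomial in
/-- Iterated integration by parts on `[0, 1]` against the `m`-th derivative of a polynomial with
zeros of order `m` at both endpoints. -/
theorem integral_iterate_derivative_mul (m : ℕ) (F : ℝ[X]) (hF : (X * (1 - X)) ^ m ∣ F)
    (g : ℕ → ℝ → ℝ) (hg : ∀ i, ∀ x ∈ Set.Icc (0 : ℝ) 1, HasDerivAt (g i) (g (i + 1) x) x) :
    ∫ x in (0 : ℝ)..1, (derivative^[m] F).eval x * g 0 x =
      (-1) ^ m * ∫ x in (0 : ℝ)..1, F.eval x * g m x := by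
  induction m generalizing F with
  | zero => simp
  | succ m ih =>
    have hF' : (X * (1 - X)) ^ m ∣ derivative F := by
      simpa using pow_sub_one_dvd_derivative_of_pow_dvd hF
    have huIcc : Set.uIcc (0 : ℝ) 1 = Set.Icc 0 1 := Set.uIcc_of_le zero_le_one
    have hcont : ∀ i, ContinuousOn (g i) (Set.uIcc 0 1) := fun i x hx =>
      (hg i x (huIcc ▸ hx)).continuousAt.continuousWithinAt
    have hdvd : X * (1 - X) ∣ F := (dvd_pow_self _ m.succ_ne_zero).trans hF
    have h0 : F.eval 0 = 0 := by
      obtain ⟨q, rfl⟩ := hdvd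
      simp
    have h1 : F.eval 1 = 0 := by
      obtain ⟨q, rfl⟩ := hdvd
      simp
    rw [Function.iterate_succ_apply, ih _ hF', pow_succ, mul_assoc]
    congr 1
    have key := intervalIntegral.integral_mul_deriv_eq_deriv_mul (a := 0) (b := 1)
      (u := fun x => F.eval x) (u' := fun x => (derivative F).eval x) (v := g m) (v' := g (m + 1))
      (fun x _ => F.hasDerivAt x) (fun x hx => hg m x (huIcc ▸ hx))
      ((derivative F).continuous.intervalIntegrable _ _) ((hcont _).intervalIntegrable)
    rw [key, h0, h1]
    ring

/-- The derivative of `x ↦ (x + u)⁻ᵏ` times an ascending factorial. -/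
theorem hasDerivAt_ascFactorial_mul_inv_pow (j i : ℕ) {x u : ℝ} (h : x + u ≠ 0) :
    HasDerivAt (fun x : ℝ => (-1) ^ i * ((j + 1).ascFactorial i : ℝ) * ((x + u)⁻¹) ^ (j + 1 + i))
      ((-1) ^ (i + 1) * ((j + 1).ascFactorial (i + 1) : ℝ) * ((x + u)⁻¹) ^ (j + 1 + (i + 1))) x := by
  have h1 : HasDerivAt (fun x : ℝ => (x + u)⁻¹) (-1 / (x + u) ^ 2) x :=
    ((hasDerivAt_id x).add_const u).inv h
  have h2 := (h1.pow (j + 1 + i)).const_mul ((-1) ^ i * ((j + 1).ascFactorial i : ℝ))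
  refine h2.congr_deriv ?_
  rw [Nat.ascFactorial_succ, show j + 1 + i - 1 = j + i by omega, neg_div, one_div, ← inv_pow]
  push_cast
  ring

open Polynomial in
/-- The `m`-th derivative of a Cauchy kernel multiplied by `xʰ`, `h ≤ m`, is transferred to a
polynomial with zeros of order `m` at the endpoints. -/
theorem integral_iterate_derivative_mul_pow_div (h m : ℕ) (hhm : h ≤ m) (F : ℝ[X])
    (hF : (X * (1 - X)) ^ m ∣ F) {u : ℝ} (hu : 0 < u) :
    ∫ x in (0 : ℝ)..1, (derivative^[m] F).eval x * (x ^ h * (x + u)⁻¹) =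
      (-u) ^ h * (m.factorial : ℝ) * ∫ x in (0 : ℝ)..1, F.eval x * ((x + u)⁻¹) ^ (m + 1) := by
  -- Division by `x + u`: the kernel `x^h/(x+u)` is a polynomial of degree below `m`, killed by
  -- `D^m`, plus `(-u)^h/(x+u)`.
  obtain ⟨P, hP, hPd⟩ : ∃ P : ℝ[X], X ^ h = P * (X + C u) + C ((-u) ^ h) ∧
      derivative^[m] P = 0 := by
    have hmod : (X : ℝ[X]) ^ h %ₘ (X - C (-u)) = C ((-u) ^ h) := by
      rw [modByMonic_X_sub_C_eq_C_eval]; simp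
    refine ⟨X ^ h /ₘ (X - C (-u)), ?_, ?_⟩
    · conv_lhs => rw [← modByMonic_add_div (X ^ h) (X - C (-u)), hmod]
      simp only [map_neg, sub_neg_eq_add]
      ring
    · rcases Nat.eq_zero_or_pos h with rfl | hh
      · have : (X ^ 0 : ℝ[X]) /ₘ (X - C (-u)) = 0 := by
          rw [divByMonic_eq_zero_iff (monic_X_sub_C _)]
          simp
        rw [this, iterate_derivative_zero]
      · refine iterate_derivative_eq_zero ?_
        rw [natDegree_divByMonic _ (monic_X_sub_C _), natDegree_X_pow, natDegree_X_sub_C]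
        omega
  have hne : ∀ x ∈ Set.Icc (0 : ℝ) 1, x + u ≠ 0 := fun x hx => by have := hx.1; positivity
  have key := integral_iterate_derivative_mul m F hF
    (fun i x => (derivative^[i] P).eval x +
      (-u) ^ h * ((-1) ^ i * ((0 + 1).ascFactorial i : ℝ) * ((x + u)⁻¹) ^ (0 + 1 + i)))
    (fun i x hx => by
      have h1 : HasDerivAt (fun x => (derivative^[i] P).eval x)
          ((derivative^[i + 1] P).eval x) x := by
        rw [Function.iterate_succ_apply']
        exact Polynomial.hasDerivAt _ x
      exact h1.add ((hasDerivAt_ascFactorial_mul_inv_pow 0 i (hne x hx)).const_mul _))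
  rw [hPd] at key
  rw [← intervalIntegral.integral_const_mul] at key ⊢
  convert key using 1
  · refine intervalIntegral.integral_congr fun x hx => ?_
    rw [Set.uIcc_of_le zero_le_one] at hx
    have h2 := congrArg (eval x) hP
    simp only [eval_pow, eval_X, eval_add, eval_mul, eval_C] at h2
    have h3 := hne x hx
    simp only [Function.iterate_zero, id_eq, pow_zero, Nat.ascFactorial_zero, Nat.cast_one]
    rw [h2]
    linear_combination (eval x (derivative^[m] F) * eval x P) * mul_inv_cancel₀ h3
  · refine intervalIntegral.integral_congr fun x hx => ?_
    simp only [eval_zero, zero_add, Nat.one_ascFactorial]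
    have : ((-1 : ℝ) ^ m) * (-1) ^ m = 1 := by rw [← mul_pow]; norm_num
    rw [add_comm 1 m]
    linear_combination (-(-u) ^ h * (m.factorial : ℝ) * eval x F * (x + u)⁻¹ ^ (m + 1)) * this

open Polynomial in
/-- The `m`-th derivative of `xᵐ / (x + u)ᵐ⁺¹` is a shifted Legendre polynomial of
`u / (x + u)`, in integrated form. -/
theorem integral_iterate_derivative_mul_pow_div_pow (m : ℕ) (F : ℝ[X])
    (hF : (X * (1 - X)) ^ m ∣ F) {u : ℝ} (hu : 0 < u) :
    ∫ x in (0 : ℝ)..1, (derivative^[m] F).eval x * (x ^ m * ((x + u)⁻¹) ^ (m + 1)) =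
      (m.factorial : ℝ) * ∫ x in (0 : ℝ)..1,
        F.eval x * (((x + u)⁻¹) ^ (m + 1) * aeval (u * (x + u)⁻¹) (shiftedLegendre m)) := by
  have hne : ∀ x ∈ Set.Icc (0 : ℝ) 1, x + u ≠ 0 := fun x hx => by have := hx.1; positivity
  -- Expanding `x^m = ((x+u) - u)^m` gives pure powers of `1/(x+u)`; after `m` derivatives the
  -- factors `(j+1)⋯(j+m)` produce the Legendre coefficients.
  have key := integral_iterate_derivative_mul m F hF
    (fun i x => ∑ j ∈ Finset.range (m + 1), ((m.choose j : ℝ) * (-u) ^ j) *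
      ((-1) ^ i * ((j + 1).ascFactorial i : ℝ) * ((x + u)⁻¹) ^ (j + 1 + i)))
    (fun i x hx => HasDerivAt.fun_sum fun j _ =>
      (hasDerivAt_ascFactorial_mul_inv_pow j i (hne x hx)).const_mul _)
  rw [← intervalIntegral.integral_const_mul] at key ⊢
  convert key using 1
  · refine intervalIntegral.integral_congr fun x hx => ?_
    rw [Set.uIcc_of_le zero_le_one] at hx
    have h3 := hne x hx
    congr 1
    have h4 : x ^ m = ((-u) + (x + u)) ^ m := by ring
    rw [h4, add_pow, Finset.sum_mul]
    refine Finset.sum_congr rfl fun j hj => ?_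
    have hj' : j ≤ m := Nat.lt_succ_iff.1 (Finset.mem_range.1 hj)
    obtain ⟨k, rfl⟩ := Nat.exists_eq_add_of_le hj'
    have h5 : (x + u) ^ k * (x + u)⁻¹ ^ k = 1 := by rw [← mul_pow, mul_inv_cancel₀ h3, one_pow]
    simp only [Nat.add_sub_cancel_left, pow_zero, Nat.ascFactorial_zero, Nat.cast_one]
    linear_combination ((-u) ^ j * ((j + k).choose j : ℝ) * (x + u)⁻¹ ^ (j + 1)) * h5
  · refine intervalIntegral.integral_congr fun x hx => ?_
    rw [shiftedLegendre, map_sum, Finset.mul_sum, Finset.mul_sum, Finset.mul_sum, Finset.mul_sum,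
      Finset.mul_sum]
    refine Finset.sum_congr rfl fun j hj => ?_
    rw [Nat.ascFactorial_eq_factorial_mul_choose]
    have : ((-1 : ℝ) ^ m) * (-1) ^ m = 1 := by rw [← mul_pow]; norm_num
    have h6 : (m + j).choose m = (j + m).choose m := by rw [add_comm]
    simp only [map_mul, map_pow, map_neg, map_one, map_natCast, aeval_X, Nat.cast_mul, h6]
    rw [neg_pow u j]
    linear_combination (-(m.factorial : ℝ) * eval x F * (x + u)⁻¹ ^ (m + 1) * (-1) ^ j *
      (m.choose j) * ((j + m).choose m) * (u * (x + u)⁻¹) ^ j) * this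

open Polynomial in
/-- Two-fold integration by parts of the Rodrigues type operator `Dᵐ xᵐ Dᵐ` against the
Cauchy kernel. -/
theorem integral_rodrigues_div (h m : ℕ) (hhm : h ≤ m) (f : ℝ[X])
    (hf : X ^ m * (1 - X) ^ (2 * m) ∣ f) {u : ℝ} (hu : 0 < u) :
    ∫ x in (0 : ℝ)..1, x ^ h * (derivative^[m] (X ^ m * derivative^[m] f)).eval x * (x + u)⁻¹ =
      (-u) ^ h * (m.factorial : ℝ) ^ 2 * ∫ x in (0 : ℝ)..1,
        f.eval x * (((x + u)⁻¹) ^ (m + 1) * aeval (u * (x + u)⁻¹) (shiftedLegendre m)) := by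
  -- The order `2m` at 1 leaves order `m` after `D^m`; at 0 the explicit factor `X^m` supplies it.
  have h1 : (X * (1 - X)) ^ m ∣ X ^ m * derivative^[m] f := by
    rw [mul_pow]
    refine mul_dvd_mul_left _ ?_
    have := pow_sub_dvd_iterate_derivative_of_pow_dvd m ((dvd_mul_left _ _).trans hf)
    rwa [show 2 * m - m = m by omega] at this
  have h2 : (X * (1 - X)) ^ m ∣ f := by
    rw [mul_pow]
    exact (mul_dvd_mul_left _ (pow_dvd_pow _ (by omega))).trans hf
  have e1 := integral_iterate_derivative_mul_pow_div h m hhm _ h1 hu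
  have e2 := integral_iterate_derivative_mul_pow_div_pow m f h2 hu
  calc _ = ∫ x in (0 : ℝ)..1, (derivative^[m] (X ^ m * derivative^[m] f)).eval x *
        (x ^ h * (x + u)⁻¹) := by
        refine intervalIntegral.integral_congr fun x _ => ?_
        ring
    _ = (-u) ^ h * (m.factorial : ℝ) * ∫ x in (0 : ℝ)..1, (derivative^[m] f).eval x *
        (x ^ m * ((x + u)⁻¹) ^ (m + 1)) := by
        rw [e1]
        congr 1
        refine intervalIntegral.integral_congr fun x _ => ?_
        simp only [eval_mul, eval_pow, eval_X]
        ring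
    _ = _ := by rw [e2]; ring

open Polynomial in
/-- If `f(x) ≤ B xʰ`, the integral of `xʰ Dᵐ xᵐ Dᵐ f / m!²`, `m = 2h`, against the Cauchy kernel
is at most `2⁻ᵐ B` times the integral of the kernel. -/
theorem abs_integral_rodrigues_div_le (h : ℕ) (f : ℝ[X])
    (hf : X ^ (2 * h) * (1 - X) ^ (2 * (2 * h)) ∣ f) {B : ℝ}
    (hfB : ∀ x ∈ Set.Icc (0 : ℝ) 1, |f.eval x| ≤ B * x ^ h) {u : ℝ} (hu : 0 < u) :
    |∫ x in (0 : ℝ)..1, x ^ h *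
        (derivative^[2 * h] (X ^ (2 * h) * derivative^[2 * h] f)).eval x * (x + u)⁻¹| ≤
      ((2 * h).factorial : ℝ) ^ 2 * (B / 4 ^ h) * ∫ x in (0 : ℝ)..1, (x + u)⁻¹ := by
  rw [integral_rodrigues_div h (2 * h) (by omega) f hf hu, abs_mul, abs_mul, abs_pow, abs_neg,
    abs_of_pos hu, abs_of_nonneg (sq_nonneg ((2 * h).factorial : ℝ))]
  have hne : ∀ x ∈ Set.Icc (0 : ℝ) 1, 0 < x + u := fun x hx => by have := hx.1; positivity
  have hinv : ContinuousOn (fun x : ℝ => (x + u)⁻¹) (Set.uIcc 0 1) := by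
    rw [Set.uIcc_of_le zero_le_one]
    exact ContinuousOn.inv₀ (by fun_prop) fun x hx => (hne x hx).ne'
  have hle : |∫ x in (0 : ℝ)..1, f.eval x * (((x + u)⁻¹) ^ (2 * h + 1) *
      aeval (u * (x + u)⁻¹) (shiftedLegendre (2 * h)))| ≤
      ∫ x in (0 : ℝ)..1, (u ^ h)⁻¹ * (B / 4 ^ h) * (x + u)⁻¹ := by
    rw [← Real.norm_eq_abs]
    refine intervalIntegral.norm_integral_le_of_norm_le zero_le_one ?_
      ((hinv.intervalIntegrable).const_mul _)
    refine Filter.Eventually.of_forall fun x hx => ?_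
    have hx' : x ∈ Set.Icc (0 : ℝ) 1 := ⟨hx.1.le, hx.2⟩
    have hxu := hne x hx'
    have hL := abs_aeval_shiftedLegendre_le_one (2 * h) (y := u * (x + u)⁻¹) (by positivity)
      (by rw [← div_eq_mul_inv, div_le_one hxu]; linarith [hx.1])
    have hx0 := hx.1
    rw [Real.norm_eq_abs, abs_mul, abs_mul, abs_of_nonneg (by positivity : 0 ≤ (x + u)⁻¹ ^ (2 * h + 1))]
    have hB : 0 ≤ B := by
      have := (abs_nonneg _).trans (hfB x hx')
      exact nonneg_of_mul_nonneg_left this (by positivity)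
    -- This pairs the `u^h` from integration by parts with the `x^h` in the bound for `f`, and is
    -- the source of `4^(-h)`.
    have hamgm : (4 * (u * x)) ^ h ≤ ((x + u) ^ 2) ^ h :=
      pow_le_pow_left₀ (by positivity) (by nlinarith [sq_nonneg (x - u)]) h
    calc _ ≤ (B * x ^ h) * ((x + u)⁻¹ ^ (2 * h + 1) * 1) := by
          gcongr
          exact hfB x hx'
      _ = B * (x ^ h * (((x + u) ^ 2) ^ h)⁻¹) * (x + u)⁻¹ := by
          rw [pow_succ, ← pow_mul, inv_pow]; ring
      _ ≤ B * (x ^ h * ((4 * (u * x)) ^ h)⁻¹) * (x + u)⁻¹ := by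
          gcongr
      _ = _ := by
          rw [mul_pow, mul_pow]
          field_simp
  rw [intervalIntegral.integral_const_mul] at hle
  calc _ ≤ u ^ h * ((2 * h).factorial : ℝ) ^ 2 *
        ((u ^ h)⁻¹ * (B / 4 ^ h) * ∫ x in (0 : ℝ)..1, (x + u)⁻¹) := by gcongr
    _ = _ := by field_simp

/-! ### Stieltjes representation of the difference quotient -/

open MeasureTheory Set in
/-- Bounds for the difference quotient of `x ↦ xᵗ` at `1`. -/
theorem one_sub_rpow_div_mem_Icc {t x : ℝ} (ht : t ∈ Icc (0 : ℝ) 1) (hx : x ∈ Ioo (0 : ℝ) 1) :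
    (1 - x ^ t) / (1 - x) ∈ Icc (0 : ℝ) 1 := by
  have h1 : x ^ t ≤ 1 := Real.rpow_le_one hx.1.le hx.2.le ht.1
  have h2 : x ≤ x ^ t := by
    simpa using Real.rpow_le_rpow_of_exponent_ge hx.1 hx.2.le ht.2
  have h3 : 0 < 1 - x := by linarith [hx.2]
  exact ⟨div_nonneg (by linarith) h3.le, (div_le_one h3).2 (by linarith)⟩

open MeasureTheory Set in
theorem integrableOn_one_sub_rpow_div {t : ℝ} (ht : t ∈ Icc (0 : ℝ) 1) :
    IntegrableOn (fun x : ℝ => (1 - x ^ t) / (1 - x)) (Ioo 0 1) := by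
  refine Integrable.of_bound (C := 1) (Measurable.aestronglyMeasurable (by fun_prop)) ?_
  refine (ae_restrict_mem measurableSet_Ioo).mono fun x hx => ?_
  obtain ⟨h0, h1⟩ := one_sub_rpow_div_mem_Icc ht hx
  rwa [Real.norm_of_nonneg h0]

open MeasureTheory Set in
/-- The difference quotient of `x ↦ xᵗ` at `1` is, for `0 < t < 1`, a Stieltjes function. -/
theorem one_sub_rpow_div_eq_integral {t x : ℝ} (ht : t ∈ Ioo (0 : ℝ) 1)
    (hx : x ∈ Ioo (0 : ℝ) 1) :
    IntegrableOn (fun u : ℝ => u ^ t * (u + 1)⁻¹ * (x + u)⁻¹) (Ioi 0) ∧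
      ∫ u in Ioi (0 : ℝ), u ^ t * (u + 1)⁻¹ * (x + u)⁻¹ =
        (∫ u in Ioi (0 : ℝ), Real.rpowIntegrand₀₁ t u 1) * ((1 - x ^ t) / (1 - x)) := by
  have h1x : 1 - x ≠ 0 := by linarith [hx.2]
  have i1 := Real.integrableOn_rpowIntegrand₀₁_Ioi ht zero_le_one
  have ix := Real.integrableOn_rpowIntegrand₀₁_Ioi ht hx.1.le
  -- Subtracting the integral representations of `1^t` and `x^t` cancels the `1/u` terms and leaves
  -- a multiple of `1 - x`.
  have heq : EqOn
      (fun u => (1 - x)⁻¹ * (Real.rpowIntegrand₀₁ t u 1 - Real.rpowIntegrand₀₁ t u x))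
      (fun u : ℝ => u ^ t * (u + 1)⁻¹ * (x + u)⁻¹) (Ioi 0) := by
    intro u hu
    have hu : (0 : ℝ) < u := hu
    have h2 : u + x ≠ 0 := by linarith [hx.1]
    have h3 : u + 1 ≠ 0 := by linarith
    simp only [Real.rpowIntegrand₀₁]
    rw [add_comm x u]
    field_simp
    ring
  refine ⟨(integrableOn_congr_fun heq measurableSet_Ioi).1 ((i1.sub ix).const_mul _), ?_⟩
  rw [← setIntegral_congr_fun measurableSet_Ioi heq, integral_const_mul, integral_sub i1 ix,
    Real.integral_rpowIntegrand₀₁_eq_rpow_mul_const ht hx.1.le]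
  field_simp

-- By Tonelli: the kernel is nonnegative and its `u`-integral is a constant times the bounded
-- difference quotient.
open MeasureTheory Set in
theorem integrable_prod_rpow_mul_inv {t : ℝ} (ht : t ∈ Ioo (0 : ℝ) 1) :
    Integrable (fun p : ℝ × ℝ => p.1 ^ t * (p.1 + 1)⁻¹ * (p.2 + p.1)⁻¹)
      ((volume.restrict (Ioi 0)).prod (volume.restrict (Ioo 0 1))) := by
  rw [integrable_prod_iff' (Measurable.aestronglyMeasurable (by fun_prop))]
  refine ⟨(ae_restrict_mem measurableSet_Ioo).mono fun x hx =>
    (one_sub_rpow_div_eq_integral ht hx).1, ?_⟩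
  refine ((integrableOn_one_sub_rpow_div (Ioo_subset_Icc_self ht)).const_mul
    (∫ u in Ioi (0 : ℝ), Real.rpowIntegrand₀₁ t u 1)).congr ?_
  refine (ae_restrict_mem measurableSet_Ioo).mono fun x hx => ?_
  beta_reduce
  rw [← (one_sub_rpow_div_eq_integral ht hx).2]
  refine setIntegral_congr_fun measurableSet_Ioi fun u hu => ?_
  have hu : (0 : ℝ) < u := hu
  have hx0 := hx.1
  exact (Real.norm_of_nonneg (by positivity)).symm

open MeasureTheory Set in
/-- Fubini's theorem for a continuous function against a Stieltjes function. -/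
theorem integral_mul_one_sub_rpow_div {t : ℝ} (ht : t ∈ Ioo (0 : ℝ) 1) {G : ℝ → ℝ}
    (hG : Continuous G) :
    IntegrableOn (fun u : ℝ => u ^ t * (u + 1)⁻¹ * ∫ x in (0 : ℝ)..1, G x * (x + u)⁻¹) (Ioi 0) ∧
      ∫ u in Ioi (0 : ℝ), u ^ t * (u + 1)⁻¹ * ∫ x in (0 : ℝ)..1, G x * (x + u)⁻¹ =
        (∫ u in Ioi (0 : ℝ), Real.rpowIntegrand₀₁ t u 1) *
          ∫ x in (0 : ℝ)..1, G x * ((1 - x ^ t) / (1 - x)) := by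
  obtain ⟨M, hM⟩ := isCompact_Icc.exists_bound_of_continuousOn (s := Icc (0 : ℝ) 1) hG.continuousOn
  have hI : Integrable
      (fun p : ℝ × ℝ => G p.2 * (p.1 ^ t * (p.1 + 1)⁻¹ * (p.2 + p.1)⁻¹))
      ((volume.restrict (Ioi 0)).prod (volume.restrict (Ioo 0 1))) := by
    refine (integrable_prod_rpow_mul_inv ht).bdd_mul (c := M)
      (Continuous.aestronglyMeasurable (by fun_prop)) ?_
    rw [Measure.prod_restrict]
    refine (ae_restrict_mem (measurableSet_Ioi.prod measurableSet_Ioo)).mono fun p hp => ?_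
    exact hM _ (Ioo_subset_Icc_self hp.2)
  have hin : ∀ u : ℝ, (u ^ t * (u + 1)⁻¹ * ∫ x in (0 : ℝ)..1, G x * (x + u)⁻¹) =
      ∫ x in Ioo (0 : ℝ) 1, G x * (u ^ t * (u + 1)⁻¹ * (x + u)⁻¹) := by
    intro u
    rw [intervalIntegral.integral_of_le zero_le_one, integral_Ioc_eq_integral_Ioo,
      ← integral_const_mul]
    congr 1
    funext x
    ring
  simp_rw [hin]
  refine ⟨hI.integral_prod_left, ?_⟩
  rw [integral_integral_swap hI, intervalIntegral.integral_of_le zero_le_one,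
    integral_Ioc_eq_integral_Ioo, ← integral_const_mul]
  refine setIntegral_congr_fun measurableSet_Ioo fun x hx => ?_
  rw [integral_const_mul, (one_sub_rpow_div_eq_integral ht hx).2]
  ring

open MeasureTheory Set in
/-- A bound for all Cauchy kernels carries over to the Stieltjes functions `(1 - xᵗ) / (1 - x)`. -/
theorem abs_integral_mul_one_sub_rpow_div_le {t : ℝ} (ht : t ∈ Ioo (0 : ℝ) 1) {G : ℝ → ℝ}
    (hG : Continuous G) {B : ℝ}
    (hB : ∀ u : ℝ, 0 < u → |∫ x in (0 : ℝ)..1, G x * (x + u)⁻¹| ≤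
      B * ∫ x in (0 : ℝ)..1, (x + u)⁻¹) :
    |∫ x in (0 : ℝ)..1, G x * ((1 - x ^ t) / (1 - x))| ≤
      B * ∫ x in (0 : ℝ)..1, (1 - x ^ t) / (1 - x) := by
  obtain ⟨iG, eG⟩ := integral_mul_one_sub_rpow_div ht hG
  -- Taking `G = 1` turns the integrated upper bound back into the difference quotient, with the
  -- same constant.
  obtain ⟨i1, e1⟩ := integral_mul_one_sub_rpow_div ht (continuous_const (y := (1 : ℝ)))
  simp only [one_mul] at i1 e1
  have hC := Real.integral_rpowIntegrand₀₁_one_pos ht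
  refine le_of_mul_le_mul_left ?_ hC
  rw [← abs_of_pos hC, ← abs_mul, abs_of_pos hC, ← eG, mul_left_comm, ← e1, ← integral_const_mul,
    ← Real.norm_eq_abs]
  refine norm_integral_le_of_norm_le (i1.const_mul _) ?_
  refine (ae_restrict_mem measurableSet_Ioi).mono fun u hu => ?_
  have hu : (0 : ℝ) < u := hu
  rw [Real.norm_eq_abs, abs_mul, abs_of_nonneg (by positivity : 0 ≤ u ^ t * (u + 1)⁻¹),
    mul_left_comm]
  exact mul_le_mul_of_nonneg_left (hB u hu) (by positivity)

open MeasureTheory Set in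
theorem intervalIntegrable_mul_one_sub_rpow_div {t : ℝ} (ht : t ∈ Icc (0 : ℝ) 1) {G : ℝ → ℝ}
    (hG : Continuous G) :
    IntervalIntegrable (fun x : ℝ => G x * ((1 - x ^ t) / (1 - x))) volume 0 1 := by
  have h : IntervalIntegrable (fun x : ℝ => (1 - x ^ t) / (1 - x)) volume 0 1 :=
    (intervalIntegrable_iff_integrableOn_Ioo_of_le zero_le_one).2 (integrableOn_one_sub_rpow_div ht)
  exact h.continuousOn_mul hG.continuousOn

/-! ### Moments and the remainders of Euler's series -/

/-- The moments of the function `(1 - xᵗ) / (1 - x)`. -/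
noncomputable def eulerMoment (N : ℕ) (t : ℝ) : ℝ :=
  ∫ x in (0 : ℝ)..1, x ^ N * ((1 - x ^ t) / (1 - x))

open MeasureTheory Set in
theorem eulerMoment_mem_Icc (N : ℕ) {t : ℝ} (ht : t ∈ Icc (0 : ℝ) 1) :
    eulerMoment N t ∈ Icc (0 : ℝ) (1 / (N + 1)) := by
  have hi := intervalIntegrable_mul_one_sub_rpow_div ht (continuous_pow N)
  constructor
  · rw [eulerMoment, intervalIntegral.integral_of_le zero_le_one, integral_Ioc_eq_integral_Ioo]
    refine setIntegral_nonneg measurableSet_Ioo fun x hx => ?_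
    exact mul_nonneg (pow_nonneg hx.1.le _) (one_sub_rpow_div_mem_Icc ht hx).1
  · have : ∫ x in (0 : ℝ)..1, x ^ N = 1 / (N + 1) := by simp [integral_pow]
    rw [← this]
    refine intervalIntegral.integral_mono_on_of_le_Ioo zero_le_one hi
      ((continuous_pow N).intervalIntegrable _ _) fun x hx => ?_
    exact mul_le_of_le_one_right (pow_nonneg hx.1.le _) (one_sub_rpow_div_mem_Icc ht hx).2

-- Monotonicity in `t` serves to give integrability in `t`.
open MeasureTheory Set in
theorem monotoneOn_eulerMoment (N : ℕ) : MonotoneOn (eulerMoment N) (Icc 0 1) := by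
  intro s hs t ht hst
  refine intervalIntegral.integral_mono_on_of_le_Ioo zero_le_one
    (intervalIntegrable_mul_one_sub_rpow_div hs (continuous_pow N))
    (intervalIntegrable_mul_one_sub_rpow_div ht (continuous_pow N)) fun x hx => ?_
  have h3 : 0 < 1 - x := by linarith [hx.2]
  have := Real.rpow_le_rpow_of_exponent_ge hx.1 hx.2.le hst
  have h4 := pow_nonneg hx.1.le N
  gcongr

open MeasureTheory Set in
theorem intervalIntegrable_eulerMoment (N : ℕ) :
    IntervalIntegrable (eulerMoment N) volume 0 1 := by
  refine MonotoneOn.intervalIntegrable ?_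
  rw [uIcc_of_le zero_le_one]
  exact monotoneOn_eulerMoment N

-- The factor `1 - x` cancels the denominator, leaving the integral of `x^N - x^(N+t)`.
open MeasureTheory Set in
theorem eulerMoment_sub_succ (N : ℕ) {t : ℝ} (ht : t ∈ Icc (0 : ℝ) 1) :
    eulerMoment N t - eulerMoment (N + 1) t = 1 / (N + 1) - 1 / (N + 1 + t) := by
  rw [eulerMoment, eulerMoment, ← intervalIntegral.integral_sub
    (intervalIntegrable_mul_one_sub_rpow_div ht (continuous_pow N))
    (intervalIntegrable_mul_one_sub_rpow_div ht (continuous_pow (N + 1)))]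
  have hN : (0 : ℝ) ≤ N := N.cast_nonneg
  have e1 : ∫ x in (0 : ℝ)..1, x ^ N = 1 / (N + 1) := by simp [integral_pow]
  have e2 : ∫ x in (0 : ℝ)..1, x ^ ((N : ℝ) + t) = 1 / (N + 1 + t) := by
    rw [integral_rpow (Or.inl (by linarith [ht.1]))]
    rw [Real.one_rpow, Real.zero_rpow (by linarith [ht.1])]
    ring
  rw [← e1, ← e2, ← intervalIntegral.integral_sub ((continuous_pow N).intervalIntegrable _ _)
    (intervalIntegral.intervalIntegrable_rpow' (by linarith [ht.1])),
    intervalIntegral.integral_of_le zero_le_one, intervalIntegral.integral_of_le zero_le_one,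
    integral_Ioc_eq_integral_Ioo, integral_Ioc_eq_integral_Ioo]
  refine setIntegral_congr_fun measurableSet_Ioo fun x hx => ?_
  have h3 : 1 - x ≠ 0 := by linarith [hx.2]
  rw [Real.rpow_add hx.1, Real.rpow_natCast]
  field_simp
  ring

open MeasureTheory Set in
theorem integral_eulerMoment_sub_succ (N : ℕ) :
    (∫ t in (0 : ℝ)..1, eulerMoment N t) - ∫ t in (0 : ℝ)..1, eulerMoment (N + 1) t =
      eulerPartialSum (N + 1) - eulerPartialSum N := by
  rw [← intervalIntegral.integral_sub (intervalIntegrable_eulerMoment N)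
    (intervalIntegrable_eulerMoment (N + 1)), eulerPartialSum, eulerPartialSum,
    Finset.sum_Icc_succ_top (by omega), add_sub_cancel_left]
  have hN : (0 : ℝ) < N + 1 := by positivity
  have hne : (0 : ℝ) ∉ uIcc ((N : ℝ) + 1 + 0) (N + 1 + 1) := by
    rw [uIcc_of_le (by linarith)]
    rintro ⟨h, -⟩
    linarith
  have hlog : ∫ t in (0 : ℝ)..1, 1 / ((N : ℝ) + 1 + t) = Real.log ((N + 1 + 1) / (N + 1)) := by
    rw [intervalIntegral.integral_comp_add_left (fun t => 1 / t), integral_one_div hne, add_zero]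
  have hint : IntervalIntegrable (fun t : ℝ => 1 / ((N : ℝ) + 1 + t)) volume 0 1 := by
    refine ContinuousOn.intervalIntegrable ?_
    rw [uIcc_of_le zero_le_one]
    exact continuousOn_const.div (by fun_prop) fun x hx => by linarith [hx.1]
  calc _ = ∫ t in (0 : ℝ)..1, (1 / ((N : ℝ) + 1) - 1 / (N + 1 + t)) := by
        refine intervalIntegral.integral_congr fun t ht => ?_
        rw [uIcc_of_le zero_le_one] at ht
        exact eulerMoment_sub_succ N ht
    _ = _ := by
        rw [intervalIntegral.integral_sub (by simp) hint, hlog]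
        simp

theorem eulerPartialSum_eq (N : ℕ) :
    eulerPartialSum N = (harmonic N : ℝ) - Real.log (N + 1) := by
  induction N with
  | zero => simp [eulerPartialSum]
  | succ N ih =>
    have h1 : eulerPartialSum (N + 1) = eulerPartialSum N +
        (1 / ((N + 1 : ℕ) : ℝ) - Real.log ((((N + 1 : ℕ) : ℝ) + 1) / ((N + 1 : ℕ) : ℝ))) := by
      rw [eulerPartialSum, Finset.sum_Icc_succ_top (by omega)]
      rfl
    rw [h1, ih, harmonic_succ, Real.log_div (by positivity) (by positivity)]
    push_cast
    ring

open Filter Topology in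
/-- The remainders of the series for Euler's constant as moments. -/
theorem eulerMascheroniConstant_sub_eulerPartialSum (N : ℕ) :
    Real.eulerMascheroniConstant - eulerPartialSum N = ∫ t in (0 : ℝ)..1, eulerMoment N t := by
  -- This sum does not depend on the index, so its limit determines it: the moments are at most
  -- `1/(M+1)` and the partial sums tend to `γ`.
  have hconst : ∀ k, (∫ t in (0 : ℝ)..1, eulerMoment (N + k) t) + eulerPartialSum (N + k) =
      (∫ t in (0 : ℝ)..1, eulerMoment N t) + eulerPartialSum N := by
    intro k
    induction k with
    | zero => rfl
    | succ k ih =>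
      rw [← add_assoc N k 1]
      linarith [integral_eulerMoment_sub_succ (N + k)]
  have hzero : Tendsto (fun M : ℕ => ∫ t in (0 : ℝ)..1, eulerMoment M t) atTop (𝓝 0) := by
    refine squeeze_zero (fun M => ?_) (fun M => ?_) tendsto_one_div_add_atTop_nhds_zero_nat
    · exact intervalIntegral.integral_nonneg zero_le_one fun t ht => (eulerMoment_mem_Icc M ht).1
    · calc _ ≤ ∫ t in (0 : ℝ)..1, (1 / ((M : ℝ) + 1)) :=
          intervalIntegral.integral_mono_on zero_le_one (intervalIntegrable_eulerMoment M)
            (by simp) fun t ht => (eulerMoment_mem_Icc M ht).2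
        _ = _ := by simp
  have hS : Tendsto eulerPartialSum atTop (𝓝 Real.eulerMascheroniConstant) := by
    simp_rw [funext eulerPartialSum_eq]
    exact Real.tendsto_harmonic_sub_log_add_one
  have hlim := (hzero.add hS).comp (tendsto_add_atTop_nat N)
  have hlim' : Tendsto (fun k : ℕ => (∫ t in (0 : ℝ)..1, eulerMoment N t) + eulerPartialSum N)
      atTop (𝓝 (0 + Real.eulerMascheroniConstant)) := by
    refine hlim.congr fun k => ?_
    rw [← hconst k, add_comm N k]
    rfl
  have := tendsto_nhds_unique hlim' tendsto_const_nhds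
  linarith

/-! ### The weights: Rodrigues form and normalisation -/

open Polynomial in
/-- The alternating binomial sum of squared binomial coefficients as a Rodrigues type
derivative. -/
theorem sum_choose_sq_mul_pow_eq_rodrigues (r a h M : ℕ) (hha : h ≤ a) (x : ℝ) :
    ((2 * h).factorial : ℝ) ^ 2 * ∑ k ∈ Finset.range (M + 1), (-1 : ℝ) ^ k * (M.choose k : ℝ) *
        ((r * k + (a + h)).choose (2 * h) : ℝ) ^ 2 * x ^ (r * k + a) =
      x ^ h * (derivative^[2 * h] (X ^ (2 * h) *
        derivative^[2 * h] (X ^ (a + h) * (1 - X ^ r) ^ M : ℝ[X]))).eval x := by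
  have hf : (X ^ (a + h) * (1 - X ^ r) ^ M : ℝ[X]) =
      ∑ k ∈ Finset.range (M + 1), C ((-1 : ℝ) ^ k * (M.choose k : ℝ)) * X ^ (r * k + (a + h)) := by
    rw [sub_eq_neg_add, add_pow, Finset.mul_sum]
    refine Finset.sum_congr rfl fun k _ => ?_
    rw [neg_pow, ← pow_mul]
    simp only [map_mul, map_pow, map_neg, map_one, one_pow, map_natCast]
    ring
  rw [hf, iterate_derivative_sum, Finset.mul_sum, Finset.mul_sum, iterate_derivative_sum,
    eval_finsetSum, Finset.mul_sum]
  refine Finset.sum_congr rfl fun k _ => ?_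
  rw [iterate_derivative_C_mul, iterate_derivative_X_pow_eq_C_mul]
  -- Since `h ≤ a`, the truncated exponent is a true difference. `X^m D^m` only rescales each
  -- monomial, so the second `D^m` squares the binomial coefficient.
  have hpow : (X ^ (2 * h) * (C ((-1 : ℝ) ^ k * (M.choose k : ℝ)) *
      (C (((r * k + (a + h)).descFactorial (2 * h) : ℕ) : ℝ) *
        X ^ (r * k + (a + h) - 2 * h))) : ℝ[X]) =
      C ((-1 : ℝ) ^ k * (M.choose k : ℝ) *
        (((r * k + (a + h)).descFactorial (2 * h) : ℕ) : ℝ)) * X ^ (r * k + (a + h)) := by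
    conv_rhs => rw [show r * k + (a + h) = 2 * h + (r * k + (a + h) - 2 * h) by omega, pow_add]
    rw [show 2 * h + (r * k + (a + h) - 2 * h) = r * k + (a + h) by omega]
    simp only [C_mul]
    ring
  rw [hpow, iterate_derivative_C_mul, iterate_derivative_X_pow_eq_C_mul]
  simp only [eval_mul, eval_C, eval_pow, eval_X]
  rw [Nat.descFactorial_eq_factorial_mul_choose,
    show r * k + a = h + (r * k + (a + h) - 2 * h) by omega, pow_add]
  push_cast
  ring

open Polynomial in
/-- The alternating binomial sum of squared binomial coefficients is a top-order finite
difference of a polynomial. -/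
theorem sum_choose_sq (r e m : ℕ) (hr : 0 < r) :
    ((m.factorial : ℝ) ^ 2) * ∑ k ∈ Finset.range (2 * m + 1),
        (-1 : ℝ) ^ k * ((2 * m).choose k : ℝ) * ((r * k + e).choose m : ℝ) ^ 2 =
      ((2 * m).factorial : ℝ) * (r : ℝ) ^ (2 * m) := by
  have hr' : (r : ℝ) ≠ 0 := by positivity
  let q : ℝ[X] := C (r : ℝ) * X + C (e : ℝ)
  have hq : q.natDegree = 1 := natDegree_linear hr'
  have hql : q.leadingCoeff = r := leadingCoeff_linear hr'
  let P : ℝ[X] := ((descPochhammer ℝ m).comp q) ^ 2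
  have hdeg : P.natDegree = 2 * m := by
    simp [P, natDegree_pow, natDegree_comp, hq]
  have hlead : P.leadingCoeff = (r : ℝ) ^ (2 * m) := by
    simp only [P, leadingCoeff_pow, leadingCoeff_comp (hq.trans_ne one_ne_zero), hql,
      (monic_descPochhammer ℝ m).leadingCoeff, descPochhammer_natDegree]
    ring
  have key := congrFun P.fwdDiff_iter_degree_eq_factorial 0
  rw [fwdDiff_iter_eq_sum_shift, hdeg, hlead] at key
  have key' : ∑ k ∈ Finset.range (2 * m + 1),
      ((-1 : ℤ) ^ (2 * m - k) * (2 * m).choose k) • P.eval (0 + k • (1 : ℝ)) =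
      ((2 * m).factorial : ℝ) * (r : ℝ) ^ (2 * m) := by
    rw [key]; simp [mul_comm]
  rw [← key', Finset.mul_sum]
  refine Finset.sum_congr rfl fun k hk => ?_
  have hk' : k ≤ 2 * m := Nat.lt_succ_iff.1 (Finset.mem_range.1 hk)
  have hsign : (-1 : ℝ) ^ (2 * m - k) = (-1) ^ k := by
    rw [neg_one_pow_eq_pow_mod_two, neg_one_pow_eq_pow_mod_two (n := k)]
    congr 1
    omega
  have heval : P.eval (0 + k • (1 : ℝ)) = ((m.factorial : ℝ) * ((r * k + e).choose m : ℝ)) ^ 2 := by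
    have : eval (k : ℝ) q = ((r * k + e : ℕ) : ℝ) := by simp [q]
    simp only [P, eval_pow, eval_comp, zero_add, nsmul_eq_mul, mul_one, this]
    rw [descPochhammer_eval_eq_descFactorial, Nat.descFactorial_eq_factorial_mul_choose]
    push_cast
    ring
  rw [heval, zsmul_eq_mul]
  push_cast
  rw [hsign]
  ring

/-! ### The error estimate -/

open MeasureTheory Set Polynomial in
/-- Error bound for the alternating binomial sums of moments. -/
theorem abs_sum_mul_eulerMoment_le (r a h : ℕ) (hha : h ≤ a) {B : ℝ}
    (hB : ∀ x ∈ Icc (0 : ℝ) 1, x ^ a * (1 - x ^ r) ^ (4 * h) ≤ B) {t : ℝ} (ht : t ∈ Ioo (0 : ℝ) 1) :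
    |∑ k ∈ Finset.range (4 * h + 1), (-1 : ℝ) ^ k * ((4 * h).choose k : ℝ) *
        ((r * k + (a + h)).choose (2 * h) : ℝ) ^ 2 * eulerMoment (r * k + a) t| ≤
      B / 4 ^ h * eulerMoment 0 t := by
  set G : ℝ → ℝ := fun x => ∑ k ∈ Finset.range (4 * h + 1), (-1 : ℝ) ^ k *
    ((4 * h).choose k : ℝ) * ((r * k + (a + h)).choose (2 * h) : ℝ) ^ 2 * x ^ (r * k + a) with hG
  have hGc : Continuous G := by fun_prop
  have hsum : ∑ k ∈ Finset.range (4 * h + 1), (-1 : ℝ) ^ k * ((4 * h).choose k : ℝ) *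
      ((r * k + (a + h)).choose (2 * h) : ℝ) ^ 2 * eulerMoment (r * k + a) t =
      ∫ x in (0 : ℝ)..1, G x * ((1 - x ^ t) / (1 - x)) := by
    simp only [hG, Finset.sum_mul, eulerMoment]
    rw [intervalIntegral.integral_finsetSum]
    · refine Finset.sum_congr rfl fun k _ => ?_
      rw [← intervalIntegral.integral_const_mul]
      simp only [mul_assoc]
    · intro k _
      exact intervalIntegrable_mul_one_sub_rpow_div (Ioo_subset_Icc_self ht) (by fun_prop)
  have h0 : eulerMoment 0 t = ∫ x in (0 : ℝ)..1, (1 - x ^ t) / (1 - x) := by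
    simp [eulerMoment]
  rw [hsum, h0]
  refine abs_integral_mul_one_sub_rpow_div_le ht hGc fun u hu => ?_
  have hfac : (0 : ℝ) < ((2 * h).factorial : ℝ) ^ 2 := by positivity
  have hdvd : (X : ℝ[X]) ^ (2 * h) * (1 - X) ^ (2 * (2 * h)) ∣
      X ^ (a + h) * (1 - X ^ r) ^ (4 * h) := by
    refine mul_dvd_mul (pow_dvd_pow _ (by omega)) ?_
    rw [show 2 * (2 * h) = 4 * h by ring]
    exact pow_dvd_pow_of_dvd (by simpa using sub_dvd_pow_sub_pow (1 : ℝ[X]) X r) _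
  have hle := abs_integral_rodrigues_div_le h _ hdvd (B := B) (fun x hx => by
    have hxr : x ^ r ≤ 1 := pow_le_one₀ hx.1 hx.2
    have h1 : 0 ≤ x ^ (a + h) * (1 - x ^ r) ^ (4 * h) :=
      mul_nonneg (pow_nonneg hx.1 _) (pow_nonneg (by linarith) _)
    simp only [eval_mul, eval_pow, eval_X, eval_sub, eval_one]
    rw [abs_of_nonneg h1, pow_add, mul_right_comm]
    exact mul_le_mul_of_nonneg_right (hB x hx) (pow_nonneg hx.1 _)) hu
  simp_rw [← sum_choose_sq_mul_pow_eq_rodrigues r a h (4 * h) hha] at hle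
  refine le_of_mul_le_mul_left ?_ hfac
  rw [← mul_assoc]
  refine le_trans (le_of_eq ?_) hle
  rw [← abs_of_pos hfac, ← abs_mul, abs_of_pos hfac, ← intervalIntegral.integral_const_mul]
  simp only [hG, mul_assoc]

open MeasureTheory Set in
/-- Error bound for the alternating binomial sums of remainders of the series for Euler's
constant. -/
theorem abs_eulerMascheroniConstant_sub_sum_le (r a h : ℕ) (hr : 0 < r) (hha : h ≤ a) {B : ℝ}
    (hB : ∀ x ∈ Icc (0 : ℝ) 1, x ^ a * (1 - x ^ r) ^ (4 * h) ≤ B) :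
    |Real.eulerMascheroniConstant - (((2 * h).factorial : ℝ) ^ 2 /
        (((4 * h).factorial : ℝ) * (r : ℝ) ^ (4 * h))) *
          ∑ k ∈ Finset.range (4 * h + 1), (-1 : ℝ) ^ k * ((4 * h).choose k : ℝ) *
            ((r * k + (a + h)).choose (2 * h) : ℝ) ^ 2 * eulerPartialSum (r * k + a)| ≤
      (((2 * h).factorial : ℝ) ^ 2 / (((4 * h).factorial : ℝ) * (r : ℝ) ^ (4 * h))) *
        (B / 4 ^ h * Real.eulerMascheroniConstant) := by
  set p : ℝ := ((2 * h).factorial : ℝ) ^ 2 / (((4 * h).factorial : ℝ) * (r : ℝ) ^ (4 * h)) with hp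
  have hp0 : 0 ≤ p := by positivity
  set w : ℕ → ℝ := fun k => (-1 : ℝ) ^ k * ((4 * h).choose k : ℝ) *
    ((r * k + (a + h)).choose (2 * h) : ℝ) ^ 2 with hw
  have hnorm : p * ∑ k ∈ Finset.range (4 * h + 1), w k = 1 := by
    have := sum_choose_sq r (a + h) (2 * h) hr
    rw [show 2 * (2 * h) = 4 * h by ring] at this
    rw [hp, div_mul_eq_mul_div, this, div_self (by positivity)]
  -- As `S_0 = 0`, the integral of the bounding moment is `γ` itself.
  have hγ : Real.eulerMascheroniConstant = ∫ t in (0 : ℝ)..1, eulerMoment 0 t := by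
    rw [← eulerMascheroniConstant_sub_eulerPartialSum]
    simp [eulerPartialSum]
  have hdiff : Real.eulerMascheroniConstant -
      p * ∑ k ∈ Finset.range (4 * h + 1), w k * eulerPartialSum (r * k + a) =
      p * ∫ t in (0 : ℝ)..1, ∑ k ∈ Finset.range (4 * h + 1), w k * eulerMoment (r * k + a) t := by
    rw [intervalIntegral.integral_finsetSum
      fun k _ => (intervalIntegrable_eulerMoment _).const_mul _]
    simp_rw [intervalIntegral.integral_const_mul, ← eulerMascheroniConstant_sub_eulerPartialSum,
      mul_sub, Finset.sum_sub_distrib, ← Finset.sum_mul]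
    rw [mul_sub, ← mul_assoc, hnorm, one_mul]
  rw [hdiff, abs_mul, abs_of_nonneg hp0]
  refine mul_le_mul_of_nonneg_left ?_ hp0
  conv_rhs => rw [hγ]
  rw [← intervalIntegral.integral_const_mul, ← Real.norm_eq_abs]
  refine intervalIntegral.norm_integral_le_of_norm_le zero_le_one ?_
    ((intervalIntegrable_eulerMoment 0).const_mul _)
  -- The Stieltjes representation needs `t < 1`; the endpoint is a null set.
  have hne : ∀ᵐ t : ℝ, t ≠ 1 := by simp [ae_iff]
  filter_upwards [hne] with t ht1 ht
  exact abs_sum_mul_eulerMoment_le r a h hha hB ⟨ht.1, lt_of_le_of_ne ht.2 ht1⟩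

/-! ### Explicit constants -/

/-- The maximum of `xᵇ (1 - xʳ)²ᶜ` on the unit interval. -/
theorem pow_mul_one_sub_pow_le (b c r : ℕ) (hb : 0 < b) (hc : 0 < c) (hr : 0 < r) {x : ℝ}
    (hx : x ∈ Set.Icc (0 : ℝ) 1) :
    x ^ b * (1 - x ^ r) ^ (2 * c) ≤
      (b : ℝ) ^ ((b : ℝ) / r) * (2 * c * r : ℝ) ^ (2 * c) /
        ((b : ℝ) + 2 * c * r) ^ (2 * (c : ℝ) + (b : ℝ) / r) := by
  have hb' : (0 : ℝ) < b := by positivity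
  have hc' : (0 : ℝ) < c := by positivity
  have hr' : (0 : ℝ) < r := by positivity
  set T : ℝ := (b : ℝ) + 2 * c * r with hT
  have hT0 : 0 < T := by positivity
  have hy0 : 0 ≤ x ^ r := pow_nonneg hx.1 r
  have hy1 : 0 ≤ 1 - x ^ r := by linarith [pow_le_one₀ hx.1 hx.2 (n := r)]
  set y := x ^ r with hy
  have hw : (b : ℝ) / T + 2 * c * r / T = 1 := by
    rw [← add_div]; exact div_self hT0.ne'
  -- The weights are the values of `y` and `1 - y` at the maximum, so the arithmetic mean is 1; the
  -- power `T/r` then restores the exponents `b/r` and `2c`.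
  have amgm := Real.geom_mean_le_arith_mean2_weighted (w₁ := b / T) (w₂ := 2 * c * r / T)
    (p₁ := y / (b / T)) (p₂ := (1 - y) / (2 * c * r / T)) (by positivity) (by positivity)
    (by positivity) (by positivity) hw
  have hone : (b : ℝ) / T * (y / (b / T)) + 2 * c * r / T * ((1 - y) / (2 * c * r / T)) = 1 := by
    field_simp
    ring
  rw [hone] at amgm
  have hpow := Real.rpow_le_one (by positivity) amgm (z := T / r) (by positivity)
  rw [Real.mul_rpow (by positivity) (by positivity), ← Real.rpow_mul (by positivity),
    ← Real.rpow_mul (by positivity), show (b : ℝ) / T * (T / r) = b / r by field_simp,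
    show 2 * c * r / T * (T / r) = ((2 * c : ℕ) : ℝ) by push_cast; field_simp,
    Real.rpow_natCast, Real.div_rpow hy0 (by positivity), Real.div_rpow hb'.le hT0.le,
    div_pow, div_pow] at hpow
  have hyb : y ^ ((b : ℝ) / r) = x ^ b := by
    rw [hy, ← Real.rpow_natCast x r, ← Real.rpow_mul hx.1, ← Real.rpow_natCast x b]
    congr 1
    field_simp
  have hTadd : T ^ (2 * (c : ℝ) + (b : ℝ) / r) = T ^ (2 * c) * T ^ ((b : ℝ) / r) := by
    rw [Real.rpow_add hT0, ← Real.rpow_natCast T (2 * c)]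
    push_cast
    rfl
  rw [hyb] at hpow
  rw [hTadd, le_div_iff₀ (by positivity)]
  have hbr : 0 < (b : ℝ) ^ ((b : ℝ) / r) := by positivity
  have hTb : 0 < T ^ ((b : ℝ) / r) := by positivity
  have hc2 : 0 < (2 * c * r : ℝ) ^ (2 * c) := by positivity
  have hT2 : 0 < T ^ (2 * c) := by positivity
  have e : x ^ b / ((b : ℝ) ^ ((b : ℝ) / r) / T ^ ((b : ℝ) / r)) *
      ((1 - y) ^ (2 * c) / ((2 * c * r : ℝ) ^ (2 * c) / T ^ (2 * c))) =
      x ^ b * (1 - y) ^ (2 * c) * (T ^ (2 * c) * T ^ ((b : ℝ) / r)) /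
        ((b : ℝ) ^ ((b : ℝ) / r) * (2 * c * r : ℝ) ^ (2 * c)) := by
    field_simp
  rw [e] at hpow
  exact (div_le_one (by positivity)).1 hpow

/-- A lower bound for central binomial coefficients of even index. -/
theorem four_pow_mul_eulerMascheroniConstant_lt (h : ℕ) (hh : 0 < h) :
    (4 : ℝ) ^ (2 * h) * Real.eulerMascheroniConstant < (2 * h : ℝ) * (2 * h).centralBinom := by
  have hγ := Real.eulerMascheroniConstant_lt_two_thirds
  -- For `h = 1` the factor `γ` is essential, since `16 > 12`; from `h = 2` on `γ ≤ 1` suffices.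
  rcases Nat.lt_or_ge h 2 with h2 | h2
  · obtain rfl : h = 1 := by omega
    have : (2 * 1).centralBinom = 6 := by decide
    rw [this]
    norm_num
    linarith
  · have := Nat.four_pow_lt_mul_centralBinom (2 * h) (by omega)
    have h4 : (4 : ℝ) ^ (2 * h) < (2 * h : ℝ) * (2 * h).centralBinom := by exact_mod_cast this
    refine lt_of_le_of_lt ?_ h4
    exact mul_le_of_le_one_right (by positivity) (by linarith)

theorem corollary2 (b c r n : ℕ) (hb : 0 < b) (hc : 0 < c) (hr : 0 < r) (hn : 0 < n)
    (hbc : c ≤ 2 * b) (hceven : Even c) :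
    |Real.eulerMascheroniConstant -
        (((c * n).factorial : ℝ) ^ 2 / (((2 * c * n).factorial : ℝ) * (r : ℝ) ^ (2 * c * n))) *
          ∑ k ∈ Finset.range (2 * c * n + 1),
            (-1 : ℝ) ^ k * ((2 * c * n).choose k : ℝ) *
              ((r * k + (b + c / 2) * n).choose (c * n) : ℝ) ^ 2 *
              eulerPartialSum (r * k + b * n)| <
      (c : ℝ) * (n : ℝ) *
        ((b : ℝ) ^ ((b : ℝ) / (r : ℝ)) * (c : ℝ) ^ (2 * c) /
          ((2 : ℝ) ^ c *
            ((b : ℝ) + 2 * (c : ℝ) * (r : ℝ)) ^ (2 * (c : ℝ) + (b : ℝ) / (r : ℝ)))) ^ n := by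
  obtain ⟨d, rfl⟩ := hceven.two_dvd
  have hd : 0 < d := by omega
  have hmax : ∀ x ∈ Set.Icc (0 : ℝ) 1, x ^ (b * n) * (1 - x ^ r) ^ (4 * (d * n)) ≤
      ((b : ℝ) ^ ((b : ℝ) / r) * (2 * (2 * d : ℕ) * r : ℝ) ^ (2 * (2 * d)) /
        ((b : ℝ) + 2 * (2 * d : ℕ) * r) ^ (2 * ((2 * d : ℕ) : ℝ) + (b : ℝ) / r)) ^ n := by
    intro x hx
    have hy1 : 0 ≤ 1 - x ^ r := by linarith [pow_le_one₀ hx.1 hx.2 (n := r)]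
    have hx0 := hx.1
    have := pow_le_pow_left₀ (by positivity) (pow_mul_one_sub_pow_le b (2 * d) r hb hc hr hx) n
    rw [mul_pow, ← pow_mul, ← pow_mul] at this
    rwa [show 4 * (d * n) = 2 * (2 * d) * n by ring]
  -- Here `a = bn` and `h = dn` with `c = 2d`, so `h ≤ a` is the hypothesis `c ≤ 2b`.
  have hle := abs_eulerMascheroniConstant_sub_sum_le r (b * n) (d * n) hr
    (Nat.mul_le_mul_right n (by omega)) hmax
  rw [show 2 * d / 2 = d by omega, show 2 * (2 * d) * n = 4 * (d * n) by ring,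
    show 2 * d * n = 2 * (d * n) by ring, add_mul]
  refine hle.trans_lt ?_
  have hr' : (0 : ℝ) < r := by positivity
  have hb' : (0 : ℝ) < b := by positivity
  set E : ℝ := ((b : ℝ) + 2 * (2 * d : ℕ) * r) ^ (2 * ((2 * d : ℕ) : ℝ) + (b : ℝ) / r) with hE
  have hE0 : 0 < E := by positivity
  set A : ℝ := (b : ℝ) ^ ((b : ℝ) / r) with hA
  have hA0 : 0 < A := by positivity
  have hbinom := four_pow_mul_eulerMascheroniConstant_lt (d * n) (by positivity)
  have hcb : ((2 * (d * n)).factorial : ℝ) ^ 2 * ((2 * (d * n)).centralBinom : ℝ) =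
      ((4 * (d * n)).factorial : ℝ) := by
    have := Nat.choose_mul_factorial_mul_factorial
      (show 2 * (d * n) ≤ 2 * (2 * (d * n)) by omega)
    rw [show 2 * (2 * (d * n)) - 2 * (d * n) = 2 * (d * n) by omega] at this
    rw [show 4 * (d * n) = 2 * (2 * (d * n)) by ring, ← this, Nat.centralBinom]
    push_cast
    ring
  have hcb0 : (0 : ℝ) < (2 * (d * n)).centralBinom := by exact_mod_cast Nat.centralBinom_pos _
  rw [← hcb]
  set Y : ℝ := (A * ((2 * d : ℕ) : ℝ) ^ (2 * (2 * d)) / (2 ^ (2 * d) * E)) ^ n with hY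
  have hY0 : 0 < Y := by positivity
  -- The factors `r^(4dn)` and `4^(dn)` cancel in the error bound; `4^(2dn)` remains to be compared
  -- with the central binomial coefficient.
  have hYmax : (A * (2 * (2 * d : ℕ) * r : ℝ) ^ (2 * (2 * d)) / E) ^ n =
      Y * (4 ^ (2 * (d * n)) * (r : ℝ) ^ (4 * (d * n)) * 4 ^ (d * n)) := by
    have e4 : (4 : ℝ) ^ (2 * (d * n)) * (r : ℝ) ^ (4 * (d * n)) * 4 ^ (d * n) =
        (4 ^ (2 * d) * (r : ℝ) ^ (4 * d) * 4 ^ d) ^ n := by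
      rw [mul_pow, mul_pow, ← pow_mul, ← pow_mul, ← pow_mul]
      ring_nf
    rw [hY, e4, ← mul_pow]
    congr 1
    rw [show (2 * (2 * d : ℕ) * r : ℝ) = ((2 * d : ℕ) : ℝ) * (2 * r) by ring, mul_pow, mul_pow,
      show 2 * (2 * d) = 4 * d by ring, show (4 : ℝ) = 2 ^ 2 by norm_num, ← pow_mul, ← pow_mul]
    field_simp
    ring_nf
  rw [hYmax]
  have hF : (0 : ℝ) < ((2 * (d * n)).factorial : ℝ) ^ 2 := by positivity
  calc _ = Y * ((4 ^ (2 * (d * n)) * Real.eulerMascheroniConstant) /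
        (2 * (d * n)).centralBinom) := by
        field_simp
    _ < Y * (2 * ((d * n : ℕ) : ℝ)) := by
        refine mul_lt_mul_of_pos_left ?_ hY0
        rwa [div_lt_iff₀ hcb0]
    _ = _ := by
        push_cast
        ring
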